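/- Let $\mathbb{F}$ be a finite field of cardinality $2^m$ with $m\ge 2$, and let $A$ be a square matrix over $\mathbb{F}$, of any order $n$. Then there exist $n\times n$ matrices $N$ and $D$ over $\mathbb{F}$ such that $A=N+D$, $N^2=0$ and $D^{2^m}=D$. -/

import Mathlib

open Polynomial

/-! The space is a direct sum of modules `F[X]/(p)`, so take `X` acting on one, with `deg p = n +
1`. Pick `d 0, …, d n` summing to its trace. In the basis `∏ j < i, (X - d j)` it is lower
bidiagonal with diagonal `d`, apart from the last column. Let `N` take every other subdiagonal one.
Before the last vector, `D` has blocks of size at most two with distinct eigenvalues, none equal to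
`d n`, so `D` is diagonalizable over `F`, that is, `X ^ #F - X` kills it. Such a `d` fails to exist
only for `n = 1` and trace zero; then `p` is the square of a linear polynomial. -/

/-- `f` is the sum of a square-zero endomorphism and one fixed by the `#F`-th power. -/
def IsSquareZeroAddPotent {F M : Type*} [Field F] [Fintype F] [AddCommGroup M] [Module F M]
    (f : Module.End F M) : Prop :=
  ∃ N D : Module.End F M, f = N + D ∧ N ^ 2 = 0 ∧ D ^ Fintype.card F = D

/-- Every element of a field of characteristic two with at least four elements is, with one
exception in length one, the sum of a sequence in which neighbours differ and every
term differs from the last one. -/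
lemma exists_seq_sum_eq {F : Type*} [Field F] [Fintype F] [CharP F 2] (hF : 4 ≤ Fintype.card F)
    (n : ℕ) : ∀ t : F, (n = 1 → t ≠ 0) → ∃ d : ℕ → F, ∑ i ∈ Finset.range (n + 1), d i = t ∧
      (∀ i < n, d i ≠ d n) ∧ ∀ i < n, d i ≠ d (i + 1) := by
  have avoid : ∀ a b c : F, ∃ x, x ≠ a ∧ x ≠ b ∧ x ≠ c := by
    classical
    intro a b c
    obtain ⟨x, -, hx⟩ := Finset.exists_mem_notMem_of_card_lt_card
      (s := ({a, b, c} : Finset F)) (t := Finset.univ)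
      (by have := Finset.card_le_three (a := a) (b := b) (c := c)
          rw [Finset.card_univ]; omega)
    exact ⟨x, by simpa using hx⟩
  induction n using Nat.twoStepInduction with
  | zero => exact fun t _ => ⟨fun _ => t, by simp, by simp, by simp⟩
  | one =>
    intro t ht
    refine ⟨fun i => if i = 0 then t else 0, by simp, ?_, ?_⟩ <;>
    · intro i hi
      obtain rfl : i = 0 := by omega
      simpa using ht rfl
  | more n ih _ =>
    intro t _
    -- Two terms of sum `s` are prepended. As `s ≠ t`, the shorter sequence has nonzero sum, which
    -- avoids the exception.
    obtain ⟨s, hs0, hst, -⟩ := avoid 0 t 0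
    obtain ⟨d, hd, hlast, hadj⟩ := ih (t - s) (fun _ => sub_ne_zero.mpr hst.symm)
    obtain ⟨x, hx0, hxs, hxd⟩ := avoid 0 s (s - (d 0 - d n))
    have h2 : d n + d n = 0 := CharTwo.add_self_eq_zero _
    have hxx : x + x = 0 := CharTwo.add_self_eq_zero _
    refine ⟨fun i => match i with
      | 0 => d n + x
      | 1 => d n + (s - x)
      | i + 2 => d i, ?_, ?_, ?_⟩
    · rw [Finset.sum_range_succ', Finset.sum_range_succ']
      simp only [hd]
      linear_combination h2
    · rintro (_ | _ | i) hi
      · simpa using hx0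
      · simpa [sub_eq_zero] using hxs.symm
      · exact hlast i (by omega)
    · rintro (_ | _ | i) hi
      · intro h
        apply hs0
        simp only at h
        linear_combination hxx - h
      · intro h
        apply hxd
        simp only at h
        linear_combination -h
      · exact hadj i (by omega)

lemma prod_X_sub_C_eq_X_pow_card_sub_X (F : Type*) [Field F] [Fintype F] :
    ∏ a : F, (X - C a) = X ^ Fintype.card F - X := by
  have hdeg := FiniteField.X_pow_card_sub_X_natDegree_eq F (Fintype.one_lt_card (α := F))
  have hroots := FiniteField.roots_X_pow_card_sub_X F
  have hmonic : (X ^ Fintype.card F - X : F[X]).Monic :=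
    monic_X_pow_sub (by rw [degree_X]; exact_mod_cast Fintype.one_lt_card)
  have h := prod_multiset_X_sub_C_of_monic_of_roots_card_eq hmonic
    (by rw [hroots, hdeg]; rfl)
  rw [hroots] at h
  exact h

/-! ### Newton bases -/

section NewtonSequence

variable {F : Type*} [Field F]

/-- The partial products `∏ j < i, (X - d j)`. -/
noncomputable def newtonSequence (d : ℕ → F) : Polynomial.Sequence F where
  elems' i := ∏ j ∈ Finset.range i, (X - C (d j))
  degree_eq' i := by simp [degree_prod]

lemma newtonSequence_apply (d : ℕ → F) (i : ℕ) :
    newtonSequence d i = ∏ j ∈ Finset.range i, (X - C (d j)) := rfl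

lemma newtonSequence_succ (d : ℕ → F) (i : ℕ) :
    newtonSequence d (i + 1) = (X - C (d i)) * newtonSequence d i := by
  rw [newtonSequence_apply, newtonSequence_apply, Finset.prod_range_succ_comm]

lemma span_newtonSequence (d : ℕ → F) (m : ℕ) :
    Submodule.span F (newtonSequence d '' Set.Iio m) = degreeLT F m :=
  (newtonSequence d).span_degreeLT fun i _ => by simp

end NewtonSequence

namespace IsSquareZeroAddPotent

variable {F : Type*} [Field F] [Fintype F]

lemma conj {M M' : Type*} [AddCommGroup M] [Module F M] [AddCommGroup M'] [Module F M']
    (e : M ≃ₗ[F] M') {f : Module.End F M} (hf : IsSquareZeroAddPotent f) :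
    IsSquareZeroAddPotent (e.conjAlgEquiv F f) := by
  obtain ⟨N, D, rfl, hN, hD⟩ := hf
  exact ⟨e.conjAlgEquiv F N, e.conjAlgEquiv F D, map_add _ _ _, by rw [← map_pow, hN, map_zero],
    by rw [← map_pow, hD]⟩

open DirectSum in
lemma directSum_lmap {ι : Type*} {M : ι → Type*} [∀ i, AddCommGroup (M i)]
    [∀ i, Module F (M i)] {f : ∀ i, Module.End F (M i)}
    (hf : ∀ i, IsSquareZeroAddPotent (f i)) :
    IsSquareZeroAddPotent (DirectSum.lmap f : Module.End F (⨁ i, M i)) := by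
  choose N D hfND hN hD using hf
  have hpow : ∀ (g : ∀ i, Module.End F (M i)) (k : ℕ),
      (DirectSum.lmap g : Module.End F (⨁ i, M i)) ^ k = DirectSum.lmap fun i => g i ^ k := by
    intro g k
    induction k with
    | zero => ext; simp
    | succ k ih => rw [pow_succ, ih]; ext; simp [pow_succ]
  refine ⟨DirectSum.lmap N, DirectSum.lmap D, ?_, ?_, ?_⟩
  · apply LinearMap.ext; intro x; apply DFinsupp.ext; intro i
    change f i (x i) = N i (x i) + D i (x i)
    rw [hfND]; rfl
  · rw [hpow]
    apply LinearMap.ext; intro x; apply DFinsupp.ext; intro i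
    change (N i ^ 2) (x i) = 0
    rw [hN]; rfl
  · rw [hpow]; simp only [hD]

lemma of_smul_sq {M : Type*} [AddCommGroup M] [Module F M] (f : Module.End F M) (a : F)
    (h : (f - algebraMap F _ a) ^ 2 = 0) : IsSquareZeroAddPotent f :=
  ⟨f - algebraMap F _ a, algebraMap F _ a, by simp, h, by
    rw [← map_pow, FiniteField.pow_card]⟩

/-! ### Cyclic blocks -/

/-- An endomorphism in Hessenberg form, whose last column vanishes above the diagonal modulo the
other basis vectors, decomposes when the diagonal has no repeated neighbours and does
not meet its last entry again. -/
lemma of_hessenberg {M : Type*} [AddCommGroup M] [Module F M] {n : ℕ} (e : ℕ → M)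
    (b : Module.Basis (Fin (n + 1)) F M) (hb : ∀ i, b i = e i) (f : Module.End F M) (d : ℕ → F)
    (hf : ∀ i < n, f (e i) = e (i + 1) + d i • e i)
    (hlast : f (e n) - d n • e n ∈ Submodule.span F (e '' Set.Iio n))
    (hd : ∀ i < n, d i ≠ d n) (hd' : ∀ i < n, d i ≠ d (i + 1)) :
    IsSquareZeroAddPotent f := by
  classical
  -- Parity is counted from the end: `N` kills `e n` and takes `e (n - 1)` to `e n`, so `D`
  -- preserves the span of the earlier vectors.
  let N : Module.End F M := b.constr F fun i : Fin (n + 1) =>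
    if Odd (n - (i : ℕ)) then e (i + 1) else 0
  have hN : ∀ i ≤ n, N (e i) = if Odd (n - i) then e (i + 1) else 0 := by
    intro i hi
    have h := b.constr_basis F (fun i : Fin (n + 1) =>
      if Odd (n - (i : ℕ)) then e (i + 1) else 0) ⟨i, by omega⟩
    rwa [hb] at h
  let D := f - N
  have hDodd : ∀ i < n, Odd (n - i) → D (e i) = d i • e i := by
    intro i hi ho
    simp [D, hN i hi.le, ho, hf i hi]
  have hDeven : ∀ i < n, ¬ Odd (n - i) → D (e i) = e (i + 1) + d i • e i := by
    intro i hi ho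
    simp [D, hN i hi.le, ho, hf i hi]
  have hDlast : D (e n) = f (e n) := by
    simp [D, hN n le_rfl]
  -- `g` kills the earlier vectors, and `D - d n` sends `e n` into their span.
  let s : Finset F := Finset.univ.erase (d n)
  let g : F[X] := ∏ a ∈ s, (X - C a)
  have hg : g * (X - C (d n)) = X ^ Fintype.card F - X := by
    rw [Finset.prod_erase_mul _ _ (Finset.mem_univ _), prod_X_sub_C_eq_X_pow_card_sub_X]
  have hmem : ∀ i < n, d i ∈ s := fun i hi => by simp [s, hd i hi]
  have kill : ∀ (r : F[X]) (x : M), r ∣ g → aeval D r x = 0 → aeval D g x = 0 := by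
    rintro r x ⟨u, hu⟩ hr
    rw [hu, mul_comm, map_mul, Module.End.mul_apply, hr, map_zero]
  have hgodd : ∀ i < n, Odd (n - i) → aeval D g (e i) = 0 := by
    intro i hi ho
    refine kill (X - C (d i)) _ (Finset.dvd_prod_of_mem _ (hmem i hi)) ?_
    simp [hDodd i hi ho]
  have hgall : ∀ i < n, aeval D g (e i) = 0 := by
    intro i hi
    by_cases ho : Odd (n - i)
    · exact hgodd i hi ho
    have ho' : Odd (n - (i + 1)) := by
      rw [Nat.not_odd_iff_even] at ho
      rw [← Nat.sub_sub, Nat.odd_sub (by omega)]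
      simp [ho]
    have hi' : i + 1 < n := by
      have := ho'.pos
      omega
    refine kill ((X - C (d (i + 1))) * (X - C (d i))) _ ?_ ?_
    · have : ({d (i + 1), d i} : Finset F) ⊆ s := by
        intro a ha
        simp only [Finset.mem_insert, Finset.mem_singleton] at ha
        rcases ha with rfl | rfl
        exacts [hmem _ hi', hmem _ hi]
      rw [← Finset.prod_pair (f := fun a => X - C a) (hd' i hi).symm]
      exact Finset.prod_dvd_prod_of_subset _ _ _ this
    · simp [hDeven i hi ho, hDodd _ hi' ho']
  have hgspan : ∀ x ∈ Submodule.span F (e '' Set.Iio n), aeval D g x = 0 := by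
    intro x hx
    have : Submodule.span F (e '' Set.Iio n) ≤ LinearMap.ker (aeval D g) := by
      rw [Submodule.span_le]
      rintro _ ⟨i, hi, rfl⟩
      exact hgall i hi
    exact this hx
  refine ⟨N, D, by simp [D], ?_, ?_⟩
  · refine b.ext fun i => ?_
    rw [hb, pow_two, Module.End.mul_apply, hN i (by omega)]
    split_ifs with ho
    · have hi : (i : ℕ) + 1 ≤ n := by
        have := ho.pos
        omega
      rw [hN _ hi, if_neg]
      · simp
      · rw [← Nat.sub_sub, Nat.odd_sub (by omega)]
        simp [ho]
    · simp
  · rw [← sub_eq_zero]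
    have hD : D ^ Fintype.card F - D = aeval D (g * (X - C (d n))) := by simp [hg]
    rw [hD]
    refine b.ext fun i => ?_
    rw [hb]
    obtain hi | hi := (Nat.lt_succ_iff.mp i.2).lt_or_eq
    · rw [mul_comm, map_mul, Module.End.mul_apply, hgall _ hi]
      simp
    · rw [hi, map_mul, Module.End.mul_apply]
      apply hgspan
      simpa [hDlast] using hlast

/-- Multiplication by `X` on a cyclic torsion module over `F[X]` decomposes. -/
lemma of_cyclic [CharP F 2] (hF : 4 ≤ Fintype.card F) {M : Type*} [AddCommGroup M] [Module F M]
    [Module F[X] M] [IsScalarTower F F[X] M] (π : F[X] →ₗ[F[X]] M)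
    (hπ : Function.Surjective π) {p : F[X]} (hp : p.Monic) (hker : ∀ r, π r = 0 ↔ p ∣ r) :
    IsSquareZeroAddPotent (Algebra.lsmul F F M (X : F[X])) := by
  obtain hn | ⟨n, hn⟩ : p.natDegree = 0 ∨ ∃ n, p.natDegree = n + 1 :=
    (Nat.eq_zero_or_eq_succ_pred _).imp_right fun h => ⟨_, h⟩
  · have h1 := hp.natDegree_eq_zero.mp hn
    have : Subsingleton M := by
      refine subsingleton_of_forall_eq 0 fun x => ?_
      obtain ⟨r, rfl⟩ := hπ x
      rw [hker, h1]
      exact one_dvd r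
    exact ⟨0, 0, Subsingleton.elim _ _, by simp, by simp⟩
  -- Here `d 0 + d 1 = 0` would force `d 0 = d 1`.
  by_cases hexc : n = 1 ∧ p.nextCoeff = 0
  · obtain ⟨rfl, hc⟩ := hexc
    have hp2 : p = X ^ 2 + C (p.coeff 0) := by
      rw [nextCoeff_of_natDegree_pos (by omega), hn] at hc
      have h2 : p.coeff 2 = 1 := by
        have := hp.coeff_natDegree
        rwa [hn] at this
      conv_lhs => rw [p.as_sum_range_C_mul_X_pow, hn]
      simp only [Finset.sum_range_succ, Finset.sum_range_zero]
      simp at hc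
      simp [hc, h2, add_comm]
    obtain ⟨a, ha⟩ := FiniteField.isSquare_of_char_two (ringChar.eq F 2) (p.coeff 0)
    have h2X : (X : F[X]) * C a + X * C a = 0 := CharTwo.add_self_eq_zero _
    have hpa : p = (X - C a) ^ 2 := by
      rw [hp2, ha, C_mul]
      linear_combination h2X
    refine of_smul_sq _ a (LinearMap.ext fun x => ?_)
    have hX : Algebra.lsmul F F M (X : F[X]) - algebraMap F _ a
        = Algebra.lsmul F F M (X - C a : F[X]) := by
      rw [map_sub, ← algebraMap_eq, AlgHom.commutes]
    obtain ⟨r, rfl⟩ := hπ x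
    rw [hX, ← map_pow, ← hpa, Algebra.lsmul_apply, ← map_smul, LinearMap.zero_apply, hker]
    exact dvd_mul_right _ _
  obtain ⟨d, hsum, hd, hd'⟩ := exists_seq_sum_eq hF n (-p.nextCoeff)
    (fun h h' => hexc ⟨h, neg_eq_zero.mp h'⟩)
  have hdeg : p.degree = (n + 1 : ℕ) := by rw [degree_eq_natDegree hp.ne_zero, hn]
  let πF : F[X] →ₗ[F] M := π.restrictScalars F
  let S := newtonSequence d
  have hli : LinearIndependent F fun i : Fin (n + 1) => πF (S i) := by
    have h0 : LinearIndependent F fun i : Fin (n + 1) => S i :=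
      S.linearIndependent.comp _ Fin.val_injective
    refine h0.map (f := πF) ?_
    rw [Submodule.disjoint_def]
    intro r hr hr0
    have hlt : r ∈ degreeLT F (n + 1) := by
      rw [← span_newtonSequence d]
      refine Submodule.span_mono ?_ hr
      rintro _ ⟨i, rfl⟩
      exact ⟨i, i.2, rfl⟩
    rw [mem_degreeLT, ← hdeg] at hlt
    exact eq_zero_of_dvd_of_degree_lt ((hker r).mp hr0) hlt
  have hspan : ⊤ ≤ Submodule.span F (Set.range fun i : Fin (n + 1) => πF (S i)) := by
    rintro x -
    obtain ⟨r, rfl⟩ := hπ x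
    have hr : π r = πF (r %ₘ p) := by
      change π r = π (r %ₘ p)
      rw [← sub_eq_zero, ← map_sub, hker, ← dvd_neg, neg_sub]
      exact ⟨-(r /ₘ p), by linear_combination modByMonic_add_div r p⟩
    have hlt : r %ₘ p ∈ Submodule.span F (S '' Set.Iio (n + 1)) := by
      rw [span_newtonSequence, mem_degreeLT, ← hdeg]
      exact degree_modByMonic_lt r hp
    rw [hr]
    have := Submodule.mem_map_of_mem (f := πF) hlt
    rw [Submodule.map_span] at this
    refine Submodule.span_mono ?_ this
    rintro _ ⟨_, ⟨i, hi, rfl⟩, rfl⟩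
    exact ⟨⟨i, hi⟩, rfl⟩
  have hX : ∀ i, Algebra.lsmul F F M (X : F[X]) (πF (S i))
      = πF (S (i + 1)) + d i • πF (S i) := by
    intro i
    change (X : F[X]) • π (S i) = _
    rw [← map_smul, ← map_smul, ← map_add]
    change πF _ = _
    congr 1
    rw [newtonSequence_succ, smul_eq_mul, smul_eq_C_mul]
    ring
  refine of_hessenberg (fun i => πF (S i)) (Module.Basis.mk hli hspan) (fun i => by simp) _ d
    (fun i _ => hX i) ?_ hd hd'
  -- The two top coefficients cancel, the second because `d` sums to the trace.
  have hπp : πF (S (n + 1)) = πF (S (n + 1) - p) := by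
    rw [map_sub, show πF p = 0 from (hker p).mpr dvd_rfl, sub_zero]
  rw [hX, add_sub_cancel_right, hπp]
  have hlt : S (n + 1) - p ∈ Submodule.span F (S '' Set.Iio n) := by
    rw [span_newtonSequence, mem_degreeLT, degree_lt_iff_coeff_zero]
    have hSm : (S (n + 1)).Monic := monic_prod_X_sub_C d (Finset.range (n + 1))
    have hSn : (S (n + 1)).natDegree = n + 1 := S.natDegree_eq _
    intro k hk
    rw [coeff_sub, sub_eq_zero]
    obtain rfl | rfl | hk' : k = n ∨ k = n + 1 ∨ n + 1 < k := by omega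
    · have h1 : (S (k + 1)).nextCoeff = p.nextCoeff := by
        rw [newtonSequence_apply, prod_X_sub_C_nextCoeff, hsum, neg_neg]
      rw [nextCoeff_of_natDegree_pos (by omega), nextCoeff_of_natDegree_pos (by omega),
        hSn, hn] at h1
      simpa using h1
    · have h1 := hSm.coeff_natDegree
      have h2 := hp.coeff_natDegree
      rw [hSn] at h1
      rw [hn] at h2
      exact h1.trans h2.symm
    · rw [coeff_eq_zero_of_natDegree_lt (by omega), coeff_eq_zero_of_natDegree_lt (by omega)]
  have := Submodule.mem_map_of_mem (f := πF) hlt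
  rwa [Submodule.map_span, Set.image_image] at this

lemma of_cyclic_quotient [CharP F 2] (hF : 4 ≤ Fintype.card F) {p : F[X]} (hp : p ≠ 0) :
    IsSquareZeroAddPotent
      (Algebra.lsmul F F (F[X] ⧸ Submodule.span F[X] {p}) (X : F[X])) := by
  classical
  refine of_cyclic hF (Submodule.mkQ _) (Submodule.mkQ_surjective _)
    (monic_normalize hp) fun r => ?_
  rw [Submodule.mkQ_apply, Submodule.Quotient.mk_eq_zero, normalize_dvd_iff]
  exact Ideal.mem_span_singleton

/-! ### Reduction to cyclic modules -/

open DirectSum in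
/-- Over a finite field of characteristic two with at least four elements, every endomorphism of
a finite-dimensional space decomposes. -/
theorem of_finite [CharP F 2] (hF : 4 ≤ Fintype.card F) {V : Type*} [AddCommGroup V]
    [Module F V] [Module.Finite F V] (f : Module.End F V) : IsSquareZeroAddPotent f := by
  have htors : Module.IsTorsion F[X] (Module.AEval' f) := by
    intro x
    refine ⟨⟨minpoly F f, mem_nonZeroDivisors_of_ne_zero
      (minpoly.ne_zero (Algebra.IsIntegral.isIntegral f))⟩, ?_⟩
    obtain ⟨v, rfl⟩ := (Module.AEval'.of f).surjective x
    change minpoly F f • Module.AEval.of F V f v = 0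
    rw [← Module.AEval.of_aeval_smul, minpoly.aeval]
    simp
  obtain ⟨ι, _, p, hp, k, ⟨φ⟩⟩ := Module.equiv_directSum_of_isTorsion htors
  have hsum := directSum_lmap fun i => of_cyclic_quotient hF (pow_ne_zero (k i) (hp i).ne_zero)
  let ψ := (Module.AEval'.of f).trans (φ.restrictScalars F)
  have h := hsum.conj ψ.symm
  convert h using 1
  refine LinearMap.ext fun v => ψ.injective ?_
  rw [LinearEquiv.conjAlgEquiv_apply_apply]
  simp only [LinearEquiv.symm_symm, LinearEquiv.apply_symm_apply]
  change φ (Module.AEval'.of f (f v)) = _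
  rw [← Module.AEval'.X_smul_of, map_smul]
  rfl

end IsSquareZeroAddPotent

theorem corollary3p2 {F : Type*} [Field F] [Fintype F] (m : ℕ) (hm : 2 ≤ m)
    (hF : Fintype.card F = 2 ^ m) (n : ℕ) (A : Matrix (Fin n) (Fin n) F) :
    ∃ N D : Matrix (Fin n) (Fin n) F, A = N + D ∧ N ^ 2 = 0 ∧ D ^ (2 ^ m) = D := by
  have : CharP F 2 := charP_of_card_eq_prime_pow hF
  have h4 : 4 ≤ Fintype.card F := by
    rw [hF]
    exact Nat.pow_le_pow_right (n := 2) (by norm_num) hm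
  obtain ⟨N, D, hA, hN, hD⟩ :=
    IsSquareZeroAddPotent.of_finite h4 (Matrix.toLinAlgEquiv' A)
  let T : Module.End F (Fin n → F) ≃ₐ[F] Matrix (Fin n) (Fin n) F :=
    (Matrix.toLinAlgEquiv').symm
  refine ⟨T N, T D, ?_, by rw [← map_pow, hN, map_zero], by rw [← map_pow, ← hF, hD]⟩
  rw [← map_add, ← hA]
  exact (Matrix.toLinAlgEquiv'.symm_apply_apply A).symm
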